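/- Let $p\in[1,\infty)$, let $G$ be a second countable locally compact (Hausdorff) group with left Haar measure $dx$, and let $A$ be a complex Banach algebra with a two-sided contractive approximate identity that is a nondegenerate $L^p$-operator algebra, i.e. $A$ has an isometric nondegenerate representation on $L^p(\mu)$ for some measure space (a representation $\pi$ on a Banach space $E$, i.e. a bounded algebra homomorphism $\pi\colon A\to\mathcal B(E)$, is nondegenerate if the span of $\pi(A)E$ is dense in $E$). Let $M(A)$ be the multiplier algebra (double centralizers) of $A$, let $\mathrm{Inv}_1(M(A))$ be the group of invertible $t\in M(A)$ with $\|t\|=\|t^{-1}\|=1$, let $\mathrm{Ad}(t)a=tat^{-1}$, and let $\mathrm{Aut}(A)$ be the group of isometric algebra automorphisms of $A$; each of these extends to $M(A)$ by $\varphi(t)\varphi(a)=\varphi(ta)$, $\varphi(a)\varphi(t)=\varphi(at)$. A nondegenerate representation $\pi$ of $A$ on a Banach space $E$ extends uniquely to a unital representation $\widehat\pi$ of $M(A)$ on $E$. A *twisted action* of $G$ on $A$ is a pair $(\alpha,\sigma)$ of maps $\alpha\colon G\to\mathrm{Aut}(A)$ and $\sigma\colon G\times G\to\mathrm{Inv}_1(M(A))$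 such that $x\mapsto\alpha_x(a)$, $(x,y)\mapsto\sigma_{x,y}a$ and $(x,y)\mapsto a\sigma_{x,y}$ are continuous for every $a\in A$, $\alpha_1=\mathrm{id}_A$, $\sigma_{1,x}=\sigma_{x,1}=1$, $\alpha_x\alpha_y=\mathrm{Ad}(\sigma_{x,y})\circ\alpha_{xy}$, and $\alpha_z(\sigma_{x,y})\sigma_{z,xy}=\sigma_{z,x}\sigma_{zx,y}$ for all $x,y,z\in G$. Two twisted actions $(\alpha,\sigma)$ and $(\beta,\omega)$ are *exterior equivalent* if there is $\theta\colon G\to\mathrm{Inv}_1(M(A))$ such that $x\mapsto\theta_xa$ and $x\mapsto a\theta_x$ are continuous for every $a\in A$, and $\beta_x=\mathrm{Ad}(\theta_x)\circ\alpha_x$ and $\omega_{x,y}\theta_{xy}=\theta_x\alpha_x(\theta_y)\sigma_{x,y}$ for all $x,y\in G$. A *contractive covariant representation* of $(G,A,\alpha,\sigma)$ on a Banach space $E$ is a pair $(\pi,u)$, where $\pi$ is a contractive nondegenerate representation of $A$ on $E$ and $u$ is a strongly continuous map from $G$ to the invertible isometries of $E$, with $u_xu_y=\widehat\pi(\sigma_{x,y})u_{xy}$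 and $\pi(\alpha_x(a))=u_x\pi(a)u_x^{-1}$. Its integrated form is $(\pi\rtimes u)(f)=\int_G\pi(f(x))u_x\,dx$ for $f\in L^1(G;A)$ (the integral being taken in the strong sense). The *full $L^p$-twisted crossed product* $F^p(G,A,\alpha,\sigma)$ is the Banach algebra obtained as the Hausdorff completion of $L^1(G;A)$, with the product $$(f*g)(x)=\int_G f(y)\,\alpha_y\big(g(y^{-1}x)\big)\,\sigma_{y,y^{-1}x}\,dy,$$ with respect to the seminorm $\|f\|=\sup\|(\pi\rtimes u)(f)\|$, where the supremum is over all contractive covariant representations $(\pi,u)$ of $(G,A,\alpha,\sigma)$ on spaces $L^p(\Omega,\mu)$ with $\mu$ $\sigma$-finite. If $(\alpha,\sigma)$ and $(\beta,\omega)$ are exterior equivalent twisted actions of $G$ on $A$, then $F^p(G,A,\alpha,\sigma)$ and $F^p(G,A,\beta,\omega)$ are isometrically isomorphic as Banach algebras. -/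

import Mathlib

open MeasureTheory Filter Topology
open scoped ENNReal MultiplierAlgebra TensorProduct

universe u v w z

namespace LpCrossed

noncomputable section

set_option linter.unusedSectionVars false
set_option linter.checkUnivs false

/-! ### Approximate identities, representations, `L^p`-operator algebras -/

/-- `A` has a (two-sided) contractive approximate identity. -/
class HasCAI (A : Type*) [NonUnitalNormedRing A] : Prop where
  exists_cai : ∃ l : Filter A, l.IsApproximateUnit ∧ ∀ᶠ e in l, ‖e‖ ≤ 1

/-- A representation of a Banach algebra `A` on a Banach space `E`: a bounded algebra homomorphism
from `A` to the bounded operators on `E`. -/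
structure Rep (A : Type*) [NonUnitalNormedRing A] [NormedSpace ℂ A]
    (E : Type*) [NormedAddCommGroup E] [NormedSpace ℂ E] where
  toCLM : A →L[ℂ] (E →L[ℂ] E)
  map_mul : ∀ a b : A, toCLM (a * b) = toCLM a * toCLM b

namespace Rep

variable {A : Type*} [NonUnitalNormedRing A] [NormedSpace ℂ A]
  {E : Type*} [NormedAddCommGroup E] [NormedSpace ℂ E]

instance : CoeFun (Rep A E) fun _ => A → (E →L[ℂ] E) := ⟨fun π => π.toCLM⟩

/-- The linear span of the vectors `π(a)ξ` is dense. -/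
def IsNondegenerate (π : Rep A E) : Prop :=
  Dense (Submodule.span ℂ {ζ : E | ∃ (a : A) (ξ : E), π a ξ = ζ} : Set E)

def IsIsometric (π : Rep A E) : Prop := ∀ a : A, ‖π a‖ = ‖a‖

def IsContractive (π : Rep A E) : Prop := ‖π.toCLM‖ ≤ 1

/-- The linear map `A ⊗ E → E`, `a ⊗ ξ ↦ π(a)ξ`. -/
def action (π : Rep A E) : A ⊗[ℂ] E →ₗ[ℂ] E :=
  TensorProduct.lift (LinearMap.mk₂ ℂ (fun a ξ => π a ξ)
    (by simp) (by simp) (by simp) (by simp))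

variable [SMulCommClass ℂ A A] [IsScalarTower ℂ A A] [CompleteSpace E]

/-- The extension `π̂ : M(A) → B(E)` of a nondegenerate representation `π`: the operator `π̂(t)` is
the continuous extension of `∑ π(aᵢ)ξᵢ ↦ ∑ π(t aᵢ)ξᵢ`. -/
def hat (π : Rep A E) (t : 𝓜(ℂ, A)) : E →L[ℂ] E :=
  (π.action ∘ₗ LinearMap.rTensor E (t.fst : A →ₗ[ℂ] A)).extendOfNorm π.action

end Rep

/-- `A` is a nondegenerate `L^p`-operator algebra: it has an isometric nondegenerate
representation on `L^p(Ω, μ)` for some measure space `(Ω, μ)`. -/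
def IsNondegenerateLpOperatorAlgebra (p : ℝ≥0∞) [Fact (1 ≤ p)]
    (A : Type v) [NonUnitalNormedRing A] [NormedSpace ℂ A] : Prop :=
  ∃ (Ω : Type z) (_ : MeasurableSpace Ω) (μ : Measure Ω) (π : Rep A (Lp ℂ p μ)),
    π.IsIsometric ∧ π.IsNondegenerate

/-! ### Multipliers -/

/-- `Aut(A)`: isometric algebra automorphisms of `A`. -/
structure Aut (A : Type*) [NonUnitalNormedRing A] [NormedSpace ℂ A] extends A ≃ₗᵢ[ℂ] A where
  map_mul' : ∀ a b : A, toFun (a * b) = toFun a * toFun b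

section Multipliers

variable {A : Type*} [NonUnitalNormedRing A] [NormedSpace ℂ A] [SMulCommClass ℂ A A]
  [IsScalarTower ℂ A A]

instance : CoeFun (Aut A) fun _ => A → A := ⟨fun φ => φ.toLinearIsometryEquiv⟩

theorem Aut.map_mul (φ : Aut A) (a b : A) : φ (a * b) = φ a * φ b := φ.map_mul' a b

theorem Aut.symm_map_mul (φ : Aut A) (a b : A) :
    φ.toLinearIsometryEquiv.symm (a * b) =
      φ.toLinearIsometryEquiv.symm a * φ.toLinearIsometryEquiv.symm b := by
  apply φ.toLinearIsometryEquiv.injective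
  rw [LinearIsometryEquiv.apply_symm_apply]
  refine Eq.symm ((φ.map_mul _ _).trans ?_)
  simp

/-- `ta ∈ A` for `t ∈ M(A)` and `a ∈ A`. -/
def lact (t : 𝓜(ℂ, A)) (a : A) : A := t.fst a

/-- `at ∈ A` for `t ∈ M(A)` and `a ∈ A`. -/
def ract (a : A) (t : 𝓜(ℂ, A)) : A := t.snd a

/-- The group `Inv₁(M(A))`, as a set of units of `M(A)`. -/
def Inv₁ (A : Type*) [NonUnitalNormedRing A] [NormedSpace ℂ A] [SMulCommClass ℂ A A]
    [IsScalarTower ℂ A A] : Set 𝓜(ℂ, A)ˣ :=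
  {t | ‖(t : 𝓜(ℂ, A))‖ = 1 ∧ ‖((t⁻¹ : 𝓜(ℂ, A)ˣ) : 𝓜(ℂ, A))‖ = 1}

/-- `Ad(t)a = t a t⁻¹`. -/
def Ad (t : 𝓜(ℂ, A)ˣ) (a : A) : A :=
  ract (lact (t : 𝓜(ℂ, A)) a) ((t⁻¹ : 𝓜(ℂ, A)ˣ) : 𝓜(ℂ, A))

/-- The extension of an automorphism of `A` to `M(A)`, determined by `φ(t)φ(a) = φ(ta)` and
`φ(a)φ(t) = φ(at)`. -/
def Aut.onM (φ : Aut A) (t : 𝓜(ℂ, A)) : 𝓜(ℂ, A) where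
  fst := (φ.toLinearIsometryEquiv : A →L[ℂ] A) ∘L t.fst ∘L
    (φ.toLinearIsometryEquiv.symm : A →L[ℂ] A)
  snd := (φ.toLinearIsometryEquiv : A →L[ℂ] A) ∘L t.snd ∘L
    (φ.toLinearIsometryEquiv.symm : A →L[ℂ] A)
  central := fun x y => by
    apply φ.toLinearIsometryEquiv.symm.injective
    simp [Aut.symm_map_mul, t.central]

theorem Aut.lact_onM (φ : Aut A) (t : 𝓜(ℂ, A)) (a : A) :
    lact (φ.onM t) (φ a) = φ (lact t a) := by
  simp [lact, Aut.onM]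

theorem Aut.ract_onM (φ : Aut A) (t : 𝓜(ℂ, A)) (a : A) :
    ract (φ a) (φ.onM t) = φ (ract a t) := by
  simp [ract, Aut.onM]

theorem norm_lact_le (t : 𝓜(ℂ, A)) (a : A) : ‖lact t a‖ ≤ ‖t‖ * ‖a‖ := by
  refine (t.fst.le_opNorm a).trans ?_
  gcongr
  rw [DoubleCentralizer.norm_def]
  exact le_max_left _ _

theorem norm_ract_le (t : 𝓜(ℂ, A)) (a : A) : ‖ract a t‖ ≤ ‖t‖ * ‖a‖ := by
  refine (t.snd.le_opNorm a).trans ?_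
  gcongr
  rw [DoubleCentralizer.norm_def]
  exact le_max_right _ _

end Multipliers

section Hat

variable {A : Type*} [NonUnitalNormedRing A] [NormedSpace ℂ A] [SMulCommClass ℂ A A]
  [IsScalarTower ℂ A A] [HasCAI A]
  {E : Type*} [NormedAddCommGroup E] [NormedSpace ℂ E] [CompleteSpace E]

theorem Rep.denseRange_action {π : Rep A E} (hπ : π.IsNondegenerate) : DenseRange π.action := by
  refine hπ.mono ?_
  rw [← LinearMap.coe_range]
  refine Submodule.span_le.2 ?_
  rintro _ ⟨a, ξ, rfl⟩
  exact ⟨a ⊗ₜ ξ, by simp [Rep.action]⟩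

theorem Rep.norm_action_le (π : Rep A E) (t : 𝓜(ℂ, A)) (x : A ⊗[ℂ] E) :
    ‖(π.action ∘ₗ LinearMap.rTensor E (t.fst : A →ₗ[ℂ] A)) x‖ ≤
      ‖π.toCLM‖ * ‖t‖ * ‖π.action x‖ := by
  obtain ⟨l, hl, hl1⟩ := HasCAI.exists_cai (A := A)
  have := hl.neBot
  have key : Tendsto (fun e => π (lact t e) (π.action x)) l
      (𝓝 ((π.action ∘ₗ LinearMap.rTensor E (t.fst : A →ₗ[ℂ] A)) x)) := by
    induction x with
    | zero => simp
    | add x y hx hy => simpa using hx.add hy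
    | tmul a ξ =>
      have h1 : Tendsto (fun e => e * a) l (𝓝 a) := hl.tendsto_mul_right a
      have h2 : Tendsto (fun e => π (t.fst (e * a)) ξ) l (𝓝 (π (t.fst a) ξ)) := by
        have hc : Continuous fun b : A => π (t.fst b) ξ := by fun_prop
        exact (hc.tendsto a).comp h1
      have h3 : ∀ e : A, t.fst (e * a) = t.fst e * a := fun e => by
        have h : ∀ c : A, c * (t.fst (e * a) - t.fst e * a) = 0 := fun c => by
          rw [mul_sub, ← t.central, ← mul_assoc c, ← t.central, mul_assoc, sub_self]
        have h4 := hl.tendsto_mul_right (t.fst (e * a) - t.fst e * a)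
        simp only [h] at h4
        exact sub_eq_zero.1 (tendsto_nhds_unique h4 tendsto_const_nhds)
      simpa [Rep.action, lact, h3, π.map_mul] using h2
  refine le_of_tendsto key.norm ?_
  filter_upwards [hl1] with e he
  calc ‖π (lact t e) (π.action x)‖ ≤ ‖π (lact t e)‖ * ‖π.action x‖ :=
        ContinuousLinearMap.le_opNorm _ _
    _ ≤ (‖π.toCLM‖ * ‖lact t e‖) * ‖π.action x‖ := by
        gcongr; exact ContinuousLinearMap.le_opNorm _ _
    _ ≤ (‖π.toCLM‖ * (‖t‖ * 1)) * ‖π.action x‖ := by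
        gcongr
        exact (norm_lact_le t e).trans (by gcongr)
    _ = _ := by ring

/-- `π̂(t)π(a) = π(ta)`; for nondegenerate `π` this determines `π̂(t)`. -/
theorem Rep.hat_apply {π : Rep A E} (hπ : π.IsNondegenerate) (t : 𝓜(ℂ, A)) (a : A) (ξ : E) :
    π.hat t (π a ξ) = π (lact t a) ξ := by
  have h := LinearMap.extendOfNorm_eq (Rep.denseRange_action hπ)
    ⟨_, Rep.norm_action_le π t⟩ (a ⊗ₜ[ℂ] ξ)
  simpa [Rep.action, lact, Rep.hat] using h

theorem Rep.ext_of_nondegenerate {π : Rep A E} (hπ : π.IsNondegenerate) {S T : E →L[ℂ] E}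
    (h : ∀ a ξ, S (π a ξ) = T (π a ξ)) : S = T := by
  refine ContinuousLinearMap.ext_on hπ ?_
  rintro _ ⟨a, ξ, rfl⟩
  exact h a ξ

/-- `π(at) = π(a)π̂(t)`. -/
theorem Rep.apply_ract {π : Rep A E} (hπ : π.IsNondegenerate) (t : 𝓜(ℂ, A)) (a : A) (ξ : E) :
    π (ract a t) ξ = π a (π.hat t ξ) := by
  have : π (ract a t) = π a * π.hat t := by
    refine Rep.ext_of_nondegenerate hπ fun b η => ?_
    change (π (ract a t) * π b) η = π a (π.hat t (π b η))
    rw [Rep.hat_apply hπ, ← π.map_mul, ract, t.central, π.map_mul]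
    rfl
  rw [this]
  rfl

end Hat

/-! ### Twisted actions and exterior equivalence -/

/-- A twisted action of `G` on `A`. -/
structure TwistedAction (G : Type u) [Group G] [TopologicalSpace G]
    (A : Type v) [NonUnitalNormedRing A] [NormedSpace ℂ A] [SMulCommClass ℂ A A]
    [IsScalarTower ℂ A A] where
  α : G → Aut A
  σ : G → G → 𝓜(ℂ, A)ˣ
  σ_mem : ∀ x y, σ x y ∈ Inv₁ A
  continuous_α : ∀ a : A, Continuous fun x => α x a
  continuous_lact_σ : ∀ a : A, Continuous fun q : G × G => lact (σ q.1 q.2 : 𝓜(ℂ, A)) a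
  continuous_ract_σ : ∀ a : A, Continuous fun q : G × G => ract a (σ q.1 q.2 : 𝓜(ℂ, A))
  α_one : ∀ a : A, α 1 a = a
  σ_one_left : ∀ x, σ 1 x = 1
  σ_one_right : ∀ x, σ x 1 = 1
  α_mul : ∀ (x y : G) (a : A), α x (α y a) = Ad (σ x y) (α (x * y) a)
  cocycle : ∀ x y z : G, (α z).onM (σ x y : 𝓜(ℂ, A)) * (σ z (x * y) : 𝓜(ℂ, A)) =
    (σ z x : 𝓜(ℂ, A)) * (σ (z * x) y : 𝓜(ℂ, A))

/-- Exterior equivalence of the twisted actions `S = (α, σ)` and `T = (β, ω)`. -/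
def ExteriorEquivalent {G : Type u} [Group G] [TopologicalSpace G]
    {A : Type v} [NonUnitalNormedRing A] [NormedSpace ℂ A] [SMulCommClass ℂ A A]
    [IsScalarTower ℂ A A] (S T : TwistedAction G A) : Prop :=
  ∃ θ : G → 𝓜(ℂ, A)ˣ,
    (∀ x, θ x ∈ Inv₁ A) ∧
    (∀ a : A, Continuous fun x => lact (θ x : 𝓜(ℂ, A)) a) ∧
    (∀ a : A, Continuous fun x => ract a (θ x : 𝓜(ℂ, A))) ∧
    (∀ (x : G) (a : A), T.α x a = Ad (θ x) (S.α x a)) ∧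
    (∀ x y : G, (T.σ x y : 𝓜(ℂ, A)) * (θ (x * y) : 𝓜(ℂ, A)) =
      (θ x : 𝓜(ℂ, A)) * (S.α x).onM (θ y : 𝓜(ℂ, A)) * (S.σ x y : 𝓜(ℂ, A)))

/-! ### Covariant representations and their integrated forms -/

section Main

variable {G : Type u} [Group G] [TopologicalSpace G] [IsTopologicalGroup G]
  [LocallyCompactSpace G] [T2Space G] [SecondCountableTopology G]
  [MeasurableSpace G] [BorelSpace G]
  {A : Type v} [NonUnitalNormedRing A] [NormedSpace ℂ A] [SMulCommClass ℂ A A]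
  [IsScalarTower ℂ A A] [CompleteSpace A]

/-- A covariant representation of `(G, A, α, σ)` on a Banach space `E`. -/
structure CovariantRep {G : Type u} [Group G] [TopologicalSpace G]
    {A : Type v} [NonUnitalNormedRing A] [NormedSpace ℂ A] [SMulCommClass ℂ A A]
    [IsScalarTower ℂ A A] (T : TwistedAction G A)
    (E : Type w) [NormedAddCommGroup E] [NormedSpace ℂ E] [CompleteSpace E] where
  π : Rep A E
  nondegenerate : π.IsNondegenerate
  u : G → (E ≃ₗᵢ[ℂ] E)
  continuous_u : ∀ ξ : E, Continuous fun x => u x ξ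
  u_mul : ∀ (x y : G) (ξ : E), u x (u y ξ) = π.hat (T.σ x y : 𝓜(ℂ, A)) (u (x * y) ξ)
  covariant : ∀ (x : G) (a : A) (ξ : E), π (T.α x a) ξ = u x (π a ((u x).symm ξ))

namespace CovariantRep

variable {T : TwistedAction G A}
  {E : Type w} [NormedAddCommGroup E] [NormedSpace ℂ E] [CompleteSpace E]

theorem norm_integrand_le (R : CovariantRep T E) (f : G → A) (ξ : E) (x : G) :
    ‖R.π (f x) (R.u x ξ)‖ ≤ ‖R.π.toCLM‖ * ‖f x‖ * ‖ξ‖ := by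
  refine (ContinuousLinearMap.le_opNorm _ _).trans ?_
  rw [LinearIsometryEquiv.norm_map]
  gcongr
  exact ContinuousLinearMap.le_opNorm _ _

theorem integrable_integrand (R : CovariantRep T E) {ν : Measure G} {f : G → A}
    (hf : Integrable f ν) (ξ : E) : Integrable (fun x => R.π (f x) (R.u x ξ)) ν := by
  have hu : AEStronglyMeasurable (fun x => R.u x ξ) ν := (R.continuous_u ξ).aestronglyMeasurable
  have hc : Continuous fun q : A × E => R.π q.1 q.2 := by fun_prop
  refine Integrable.mono' ((hf.norm.const_mul ‖R.π.toCLM‖).mul_const ‖ξ‖)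
    (hc.comp_aestronglyMeasurable (hf.aestronglyMeasurable.prodMk hu)) ?_
  exact Eventually.of_forall fun x => R.norm_integrand_le f ξ x

/-- The integrated representation `π ⋊ u` on `L¹(G; A)`,
`(π ⋊ u)(f)ξ = ∫ π(f(x)) u_x ξ dx` (the operator-valued integral converges strongly). -/
def integrated (R : CovariantRep T E) (ν : Measure G) : Lp A 1 ν →L[ℂ] (E →L[ℂ] E) :=
  LinearMap.mkContinuous₂
    (LinearMap.mk₂ ℂ (fun (f : Lp A 1 ν) (ξ : E) => ∫ x, R.π (f x) (R.u x ξ) ∂ν)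
      (fun f g ξ => by
        rw [← integral_add (R.integrable_integrand (L1.integrable_coeFn f) ξ)
          (R.integrable_integrand (L1.integrable_coeFn g) ξ)]
        refine integral_congr_ae ?_
        filter_upwards [Lp.coeFn_add f g] with x hx
        rw [hx]
        simp)
      (fun c f ξ => by
        rw [← integral_smul]
        refine integral_congr_ae ?_
        filter_upwards [Lp.coeFn_smul c f] with x hx
        rw [hx]
        simp)
      (fun f ξ η => by
        rw [← integral_add (R.integrable_integrand (L1.integrable_coeFn f) ξ)
          (R.integrable_integrand (L1.integrable_coeFn f) η)]
        simp)
      (fun c f ξ => by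
        rw [← integral_smul]
        simp))
    ‖R.π.toCLM‖
    (fun f ξ => by
      simp only [LinearMap.mk₂_apply]
      calc ‖∫ x, R.π (f x) (R.u x ξ) ∂ν‖ ≤ ∫ x, ‖R.π.toCLM‖ * ‖f x‖ * ‖ξ‖ ∂ν := by
            refine norm_integral_le_of_norm_le
              (((L1.integrable_coeFn f).norm.const_mul ‖R.π.toCLM‖).mul_const ‖ξ‖) ?_
            exact Eventually.of_forall fun x => R.norm_integrand_le f ξ x
        _ = ‖R.π.toCLM‖ * ‖f‖ * ‖ξ‖ := by
            rw [integral_mul_const, integral_const_mul, L1.norm_eq_integral_norm])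

theorem integrated_apply (R : CovariantRep T E) (ν : Measure G) (f : Lp A 1 ν) (ξ : E) :
    R.integrated ν f ξ = ∫ x, R.π (f x) (R.u x ξ) ∂ν := rfl

theorem norm_integrated_le (R : CovariantRep T E) (ν : Measure G) (f : Lp A 1 ν) :
    ‖R.integrated ν f‖ ≤ ‖R.π.toCLM‖ * ‖f‖ :=
  (ContinuousLinearMap.le_opNorm _ _).trans (by
    gcongr
    exact LinearMap.mkContinuous₂_norm_le (f := _) (norm_nonneg R.π.toCLM) _)

end CovariantRep

/-! ### Twisted convolution -/

namespace TwistedAction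

variable (T : TwistedAction G A)

/-- `(f ∗ g)(x) = ∫ f(y) α_y(g(y⁻¹x)) σ_{y, y⁻¹x} dy`. -/
def convFun (ν : Measure G) (f g : G → A) (x : G) : A :=
  ∫ y, ract (f y * T.α y (g (y⁻¹ * x))) (T.σ y (y⁻¹ * x) : 𝓜(ℂ, A)) ∂ν

theorem norm_kernel_le (y z : G) (a b : A) :
    ‖ract (a * T.α y b) (T.σ y z : 𝓜(ℂ, A))‖ ≤ ‖a‖ * ‖b‖ := by
  refine (norm_ract_le _ _).trans ?_
  rw [(T.σ_mem y z).1, one_mul]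
  refine (norm_mul_le _ _).trans ?_
  rw [LinearIsometryEquiv.norm_map]

theorem continuous_kernel : Continuous fun q : (G × G) × (A × A) =>
    ract (q.2.1 * T.α q.1.1 q.2.2) (T.σ q.1.1 q.1.2 : 𝓜(ℂ, A)) := by
  have h1 : Continuous fun q : G × A => T.α q.1 q.2 := by
    refine continuous_prod_of_continuous_lipschitzWith' _ 1 (fun x => ?_) (fun a => ?_)
    · exact (T.α x).toLinearIsometryEquiv.lipschitz
    · exact T.continuous_α a
  have h2 : Continuous fun q : (G × G) × A => ract q.2 (T.σ q.1.1 q.1.2 : 𝓜(ℂ, A)) := by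
    refine continuous_prod_of_continuous_lipschitzWith' _ 1 (fun x => ?_) (fun a => ?_)
    · refine LipschitzWith.of_dist_le_mul fun a b => ?_
      have := norm_ract_le (T.σ x.1 x.2 : 𝓜(ℂ, A)) (a - b)
      rw [(T.σ_mem x.1 x.2).1] at this
      simpa [dist_eq_norm, ract] using this
    · exact T.continuous_ract_σ a
  have h3 : Continuous fun q : (G × G) × (A × A) => T.α q.1.1 q.2.2 :=
    h1.comp (f := fun q : (G × G) × (A × A) => (q.1.1, q.2.2)) (by fun_prop)
  exact h2.comp (f := fun q : (G × G) × (A × A) => (q.1, q.2.1 * T.α q.1.1 q.2.2)) (by fun_prop)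

variable {ν : Measure G} [ν.IsHaarMeasure]

theorem integrable_kernel {f g : G → A} (hf : Integrable f ν) (hg : Integrable g ν) :
    Integrable (fun q : G × G => ract (f q.1 * T.α q.1 (g q.2)) (T.σ q.1 q.2 : 𝓜(ℂ, A)))
      (ν.prod ν) := by
  refine Integrable.mono' (hf.norm.mul_prod hg.norm) ?_
    (Eventually.of_forall fun q => T.norm_kernel_le _ _ _ _)
  have hid : AEStronglyMeasurable (fun q : G × G => q) (ν.prod ν) := by
    exact continuous_id.aestronglyMeasurable
  exact T.continuous_kernel.comp_aestronglyMeasurable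
    (hid.prodMk (hf.aestronglyMeasurable.comp_fst.prodMk hg.aestronglyMeasurable.comp_snd))

theorem integrable_shear {E : Type*} [NormedAddCommGroup E] {H : G × G → E}
    (hH : Integrable H (ν.prod ν)) :
    Integrable (fun q : G × G => H (q.2, q.2⁻¹ * q.1)) (ν.prod ν) :=
  (measurePreserving_prod_inv_mul_swap ν ν).integrable_comp_of_integrable hH

theorem integrable_convKernel {f g : G → A} (hf : Integrable f ν) (hg : Integrable g ν) :
    Integrable (fun q : G × G => ract (f q.2 * T.α q.2 (g (q.2⁻¹ * q.1)))
      (T.σ q.2 (q.2⁻¹ * q.1) : 𝓜(ℂ, A))) (ν.prod ν) :=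
  integrable_shear (T.integrable_kernel hf hg)

theorem integrable_convFun {f g : G → A} (hf : Integrable f ν) (hg : Integrable g ν) :
    Integrable (T.convFun ν f g) ν :=
  (T.integrable_convKernel hf hg).integral_prod_left

/-- The twisted convolution product on `L¹(G; A)`. -/
def conv (f g : Lp A 1 ν) : Lp A 1 ν :=
  (T.integrable_convFun (L1.integrable_coeFn f) (L1.integrable_coeFn g)).toL1 _

end TwistedAction

section Multiplicative

variable [HasCAI A] {T : TwistedAction G A} {ν : Measure G} [ν.IsHaarMeasure]
  {E : Type w} [NormedAddCommGroup E] [NormedSpace ℂ E] [CompleteSpace E]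

theorem CovariantRep.kernel_apply (R : CovariantRep T E) (y z : G) (a b : A) (ξ : E) :
    R.π (ract (a * T.α y b) (T.σ y z : 𝓜(ℂ, A))) (R.u (y * z) ξ) =
      R.π a (R.u y (R.π b (R.u z ξ))) := by
  rw [Rep.apply_ract R.nondegenerate, ← R.u_mul, R.π.map_mul]
  change R.π a (R.π (T.α y b) _) = _
  rw [R.covariant, LinearIsometryEquiv.symm_apply_apply]

/-- The integrated representation is multiplicative for the twisted convolution. -/
theorem CovariantRep.integrated_conv (R : CovariantRep T E) (f g : Lp A 1 ν) :
    R.integrated ν (T.conv f g) = R.integrated ν f * R.integrated ν g := by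
  ext ξ
  change R.integrated ν (T.conv f g) ξ = R.integrated ν f (R.integrated ν g ξ)
  have hf := L1.integrable_coeFn f
  have hg := L1.integrable_coeFn g
  rw [integrated_apply, integrated_apply, integrated_apply]
  set H : G × G → E := fun q => R.π (f q.1) (R.u q.1 (R.π (g q.2) (R.u q.2 ξ))) with hH
  have hHint : Integrable H (ν.prod ν) := by
    have h := T.integrable_kernel hf hg
    have hu : AEStronglyMeasurable (fun q : G × G => R.u (q.1 * q.2) ξ) (ν.prod ν) :=
      ((R.continuous_u ξ).comp continuous_mul).aestronglyMeasurable
    have hc : Continuous fun q : A × E => R.π q.1 q.2 := by fun_prop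
    have hm := hc.comp_aestronglyMeasurable (h.aestronglyMeasurable.prodMk hu)
    simp only [R.kernel_apply] at hm
    refine Integrable.mono' ((h.norm.const_mul ‖R.π.toCLM‖).mul_const ‖ξ‖) hm ?_
    refine Eventually.of_forall fun q => ?_
    rw [hH]
    simp only
    rw [← R.kernel_apply]
    refine (ContinuousLinearMap.le_opNorm _ _).trans ?_
    rw [LinearIsometryEquiv.norm_map]
    gcongr
    exact ContinuousLinearMap.le_opNorm _ _
  have hconv : ∫ x, R.π (T.conv f g x) (R.u x ξ) ∂ν =
      ∫ x, ∫ y, H (y, y⁻¹ * x) ∂ν ∂ν := by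
    refine integral_congr_ae ?_
    filter_upwards [Integrable.coeFn_toL1 (T.integrable_convFun hf hg),
      (T.integrable_convKernel hf hg).prod_right_ae] with x hx hint
    change R.π ((Integrable.toL1 _ (T.integrable_convFun hf hg)) x) (R.u x ξ) = _
    rw [hx]
    have := (R.π.toCLM.flip (R.u x ξ)).integral_comp_comm hint
    refine Eq.trans this.symm ?_
    refine integral_congr_ae (Eventually.of_forall fun y => ?_)
    simp only [hH, ContinuousLinearMap.flip_apply]
    rw [← R.kernel_apply, mul_inv_cancel_left]
  rw [hconv, integral_integral_swap (f := fun x y => H (y, y⁻¹ * x))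
    (TwistedAction.integrable_shear hHint)]
  refine integral_congr_ae ?_
  filter_upwards [hHint.prod_right_ae] with y hy
  rw [← integral_mul_left_eq_self _ y]
  simp only [inv_mul_cancel_left, hH]
  have h2 := R.integrable_integrand hg ξ
  exact ((R.π (f y)).comp ((R.u y : E ≃L[ℂ] E) : E →L[ℂ] E)).integral_comp_comm h2

end Multiplicative

section ExtendBilin

open UniformSpace

variable {X F : Type*} [SeminormedAddCommGroup X] [NormedSpace ℂ X]
  [NormedAddCommGroup F] [NormedSpace ℂ F] [CompleteSpace F]

/-- The continuous extension of a bounded bilinear map to the completion. -/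
def extendBilin (B : X →L[ℂ] X →L[ℂ] F) : Completion X →L[ℂ] Completion X →L[ℂ] F :=
  ((B.extend (Completion.toComplL : X →L[ℂ] Completion X)).flip.extend
    (Completion.toComplL : X →L[ℂ] Completion X)).flip

theorem extendBilin_coe (B : X →L[ℂ] X →L[ℂ] F) (x y : X) :
    extendBilin B (x : Completion X) (y : Completion X) = B x y := by
  have hd : DenseRange (Completion.toComplL : X →L[ℂ] Completion X) := Completion.denseRange_coe
  have hi : IsUniformInducing (Completion.toComplL : X →L[ℂ] Completion X) :=
    Completion.isUniformInducing_coe _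
  have h1 := ContinuousLinearMap.extend_eq
    (B.extend (Completion.toComplL : X →L[ℂ] Completion X)).flip hd hi y
  have h2 := ContinuousLinearMap.extend_eq B hd hi x
  simp only [Completion.coe_toComplL] at h1 h2
  rw [extendBilin, ContinuousLinearMap.flip_apply, h1, ContinuousLinearMap.flip_apply, h2]

end ExtendBilin

/-! ### The crossed product associated with a family of covariant representations -/

/-- A uniformly bounded family of covariant representations on Banach spaces. The index type may
live in any universe, so that this covers families of all representations of a given kind. -/
structure RepFamily {G : Type u} [Group G] [TopologicalSpace G]
    {A : Type v} [NonUnitalNormedRing A] [NormedSpace ℂ A] [SMulCommClass ℂ A A]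
    [IsScalarTower ℂ A A] (T : TwistedAction G A) where
  ι : Type z
  E : ι → Type w
  [normed : ∀ i, NormedAddCommGroup (E i)]
  [space : ∀ i, NormedSpace ℂ (E i)]
  [complete : ∀ i, CompleteSpace (E i)]
  rep : ∀ i, CovariantRep T (E i)
  bounded : ∃ C : ℝ, ∀ i, ‖(rep i).π.toCLM‖ ≤ C

attribute [instance] RepFamily.normed RepFamily.space RepFamily.complete

namespace RepFamily

variable {T : TwistedAction G A}

theorem bddAbove (R : RepFamily T) (ν : Measure G) (f : Lp A 1 ν) :
    BddAbove (Set.range fun i => ‖(R.rep i).integrated ν f‖) := by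
  obtain ⟨C, hC⟩ := R.bounded
  refine ⟨C * ‖f‖, ?_⟩
  rintro _ ⟨i, rfl⟩
  exact ((R.rep i).norm_integrated_le ν f).trans (by gcongr; exact hC i)

/-- The seminorm `‖f‖_R = sup {‖(π ⋊ u)(f)‖ : (π, u) ∈ R}` on `L¹(G; A)`. -/
def seminorm (R : RepFamily T) (ν : Measure G) : Seminorm ℂ (Lp A 1 ν) :=
  Seminorm.ofSMulLE (fun f => ⨆ i, ‖(R.rep i).integrated ν f‖)
    (by simp)
    (fun f g => Real.iSup_le (fun i => by
        rw [map_add]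
        exact (norm_add_le _ _).trans
          (add_le_add (le_ciSup (R.bddAbove ν f) i) (le_ciSup (R.bddAbove ν g) i)))
      (add_nonneg (Real.iSup_nonneg fun _ => norm_nonneg _)
        (Real.iSup_nonneg fun _ => norm_nonneg _)))
    (fun c f => Real.iSup_le (fun i => by
        rw [map_smul, norm_smul]
        gcongr
        exact le_ciSup (R.bddAbove ν f) i)
      (mul_nonneg (norm_nonneg _) (Real.iSup_nonneg fun _ => norm_nonneg _)))

theorem seminorm_apply (R : RepFamily T) (ν : Measure G) (f : Lp A 1 ν) :
    R.seminorm ν f = ⨆ i, ‖(R.rep i).integrated ν f‖ := rfl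

/-- `L¹(G, A, α, σ)`, equipped with the seminorm `‖·‖_R`. -/
def L1R (_R : RepFamily T) (ν : Measure G) : Type (max u v) := Lp A 1 ν

instance (R : RepFamily T) (ν : Measure G) : SeminormedAddCommGroup (R.L1R ν) :=
  AddGroupSeminorm.toSeminormedAddCommGroup (E := Lp A 1 ν) (R.seminorm ν).toAddGroupSeminorm

instance (R : RepFamily T) (ν : Measure G) : NormedSpace ℂ (R.L1R ν) where
  __ := (inferInstance : Module ℂ (Lp A 1 ν))
  norm_smul_le c f := ((R.seminorm ν).smul' c f).le

/-- The crossed product `F_R(G, A, α, σ)`: the Hausdorff completion of `L¹(G, A, α, σ)` with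
respect to the seminorm `‖·‖_R`. -/
abbrev CrossedProduct (R : RepFamily T) (ν : Measure G) : Type (max u v) :=
  UniformSpace.Completion (R.L1R ν)

/-- The twisted convolution, on `L1R`. -/
def conv (R : RepFamily T) {ν : Measure G} [ν.IsHaarMeasure] (f g : R.L1R ν) : R.L1R ν :=
  T.conv (ν := ν) (show Lp A 1 ν from f) (show Lp A 1 ν from g)

/-- The integrated representation, on `L1R`. -/
def integratedL1R (R : RepFamily T) (ν : Measure G) (i : R.ι) :
    R.L1R ν →ₗ[ℂ] (R.E i →L[ℂ] R.E i) := ((R.rep i).integrated ν).toLinearMap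

theorem norm_eq (R : RepFamily T) {ν : Measure G} (f : R.L1R ν) :
    ‖f‖ = ⨆ i, ‖R.integratedL1R ν i f‖ := rfl

theorem norm_integratedL1R_le (R : RepFamily T) {ν : Measure G} (i : R.ι) (f : R.L1R ν) :
    ‖R.integratedL1R ν i f‖ ≤ ‖f‖ := le_ciSup (R.bddAbove ν f) i

theorem coe_eq_coe (R : RepFamily T) {ν : Measure G} {f g : R.L1R ν}
    (h : ∀ i, R.integratedL1R ν i f = R.integratedL1R ν i g) :
    (f : R.CrossedProduct ν) = g := by
  rw [← sub_eq_zero, ← UniformSpace.Completion.coe_sub, ← norm_eq_zero,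
    UniformSpace.Completion.norm_coe, norm_eq]
  simp [h]

variable [HasCAI A] {ν : Measure G} [ν.IsHaarMeasure]

theorem integratedL1R_conv (R : RepFamily T) (i : R.ι) (f g : R.L1R ν) :
    R.integratedL1R ν i (R.conv f g) = R.integratedL1R ν i f * R.integratedL1R ν i g :=
  (R.rep i).integrated_conv f g

/-- Twisted convolution as a bounded bilinear map into the crossed product. -/
def convCLM (R : RepFamily T) (ν : Measure G) [ν.IsHaarMeasure] :
    R.L1R ν →L[ℂ] R.L1R ν →L[ℂ] R.CrossedProduct ν :=
  LinearMap.mkContinuous₂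
    (LinearMap.mk₂ ℂ (fun f g : R.L1R ν => (R.conv f g : R.CrossedProduct ν))
      (fun f g h => by
        rw [← UniformSpace.Completion.coe_add]
        exact R.coe_eq_coe fun i => by simp [integratedL1R_conv, add_mul])
      (fun c f h => by
        rw [← UniformSpace.Completion.coe_smul]
        exact R.coe_eq_coe fun i => by simp [integratedL1R_conv])
      (fun f g h => by
        rw [← UniformSpace.Completion.coe_add]
        exact R.coe_eq_coe fun i => by simp [integratedL1R_conv, mul_add])
      (fun c f h => by
        rw [← UniformSpace.Completion.coe_smul]
        exact R.coe_eq_coe fun i => by simp [integratedL1R_conv]))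
    1
    (fun f g => by
      simp only [LinearMap.mk₂_apply, UniformSpace.Completion.norm_coe, one_mul]
      rw [norm_eq]
      refine Real.iSup_le (fun i => ?_) (by positivity)
      rw [integratedL1R_conv]
      refine (norm_mul_le _ _).trans ?_
      gcongr <;> exact R.norm_integratedL1R_le i _)

/-- The multiplication of the crossed product as a bounded bilinear map: the continuous extension
of the twisted convolution. -/
def mulCLM (R : RepFamily T) (ν : Measure G) [ν.IsHaarMeasure] :
    R.CrossedProduct ν →L[ℂ] R.CrossedProduct ν →L[ℂ] R.CrossedProduct ν :=
  extendBilin (R.convCLM ν)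

instance (R : RepFamily T) : Mul (R.CrossedProduct ν) := ⟨fun c d => R.mulCLM ν c d⟩

/-- The product on the crossed product extends the twisted convolution. -/
theorem coe_mul_coe (R : RepFamily T) (f g : R.L1R ν) :
    (f : R.CrossedProduct ν) * (g : R.CrossedProduct ν) = (R.conv f g : R.CrossedProduct ν) :=
  extendBilin_coe (R.convCLM ν) f g

theorem continuous_mul_crossedProduct (R : RepFamily T) :
    Continuous fun q : R.CrossedProduct ν × R.CrossedProduct ν => q.1 * q.2 :=
  (R.mulCLM ν).continuous₂

/-- The crossed product is a Banach algebra. -/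
instance (R : RepFamily T) : NonUnitalNormedRing (R.CrossedProduct ν) where
  __ := (inferInstance : NormedAddCommGroup (R.CrossedProduct ν))
  left_distrib a b c := (R.mulCLM ν a).map_add b c
  right_distrib a b c := (R.mulCLM ν).map_add₂ a b c
  zero_mul a := (R.mulCLM ν).map_zero₂ a
  mul_zero a := (R.mulCLM ν a).map_zero
  mul_assoc a b c := by
    have hc := R.continuous_mul_crossedProduct (ν := ν)
    induction a, b, c using UniformSpace.Completion.induction_on₃ with
    | hp =>
      refine isClosed_eq ?_ ?_
      · exact hc.comp ((hc.comp (continuous_fst.prodMk continuous_snd.fst)).prodMk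
          continuous_snd.snd)
      · exact hc.comp (continuous_fst.prodMk (hc.comp continuous_snd))
    | ih f g h =>
      simp only [coe_mul_coe]
      exact R.coe_eq_coe fun i => by simp [integratedL1R_conv, mul_assoc]
  norm_mul_le a b := by
    have hc := R.continuous_mul_crossedProduct (ν := ν)
    induction a, b using UniformSpace.Completion.induction_on₂ with
    | hp => exact isClosed_le hc.norm (by fun_prop)
    | ih f g =>
      rw [coe_mul_coe, UniformSpace.Completion.norm_coe, UniformSpace.Completion.norm_coe,
        UniformSpace.Completion.norm_coe, norm_eq]
      refine Real.iSup_le (fun i => ?_) (by positivity)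
      rw [integratedL1R_conv]
      refine (norm_mul_le _ _).trans ?_
      gcongr <;> exact R.norm_integratedL1R_le i _

end RepFamily

/-! ### The full `L^p`-twisted crossed product -/

/-- A contractive covariant representation on `L^p(Ω, μ)` with `μ` a `σ`-finite measure. -/
structure LpCovariantRep {G : Type u} [Group G] [TopologicalSpace G]
    {A : Type v} [NonUnitalNormedRing A] [NormedSpace ℂ A] [SMulCommClass ℂ A A]
    [IsScalarTower ℂ A A] (p : ℝ≥0∞) [Fact (1 ≤ p)] (T : TwistedAction G A) where
  Ω : Type w
  [mΩ : MeasurableSpace Ω]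
  μ : Measure Ω
  [sigmaFinite : SigmaFinite μ]
  rep : CovariantRep T (Lp ℂ p μ)
  contractive : rep.π.IsContractive

attribute [instance] LpCovariantRep.mΩ LpCovariantRep.sigmaFinite

/-- The family `R^p` of all contractive covariant representations on `L^p`-spaces of `σ`-finite
measures (on measurable spaces in the universe `w`). -/
def lpFamily (p : ℝ≥0∞) [Fact (1 ≤ p)] (T : TwistedAction G A) : RepFamily T where
  ι := LpCovariantRep.{u, v, w} p T
  E i := Lp ℂ p i.μ
  rep i := i.rep
  bounded := ⟨1, fun i => i.contractive⟩

/-- The full `L^p`-twisted crossed product `F^p(G, A, α, σ)`, formed with the left Haar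
measure `ν`. -/
abbrev FullLpCrossedProduct (p : ℝ≥0∞) [Fact (1 ≤ p)] (ν : Measure G) (T : TwistedAction G A) :
    Type (max u v) :=
  (lpFamily.{u, v, w} p T).CrossedProduct ν

end Main

end

end LpCrossed

/-! Let θ implement the equivalence from (α, σ) to (β, ω). A contractive covariant representation
(π, u) of (α, σ) yields one of (β, ω) on the same space, namely (π, v) with v_x = π̂(θ_x)u_x
(`CovariantRep.perturb`). Contractivity of π and ‖θ_x‖ = ‖θ_x⁻¹‖ = 1 make π̂(θ_x) an invertible
isometry; the two conditions on θ are exactly the covariance of v and its twisted multiplication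
rule.

Since π(f(x))π̂(θ_x) = π(f(x)θ_x), the integrated forms satisfy (π ⋊ v)(f) = (π ⋊ u)(fθ), where
(fθ)(x) = f(x)θ_x (`CovariantRep.integrated_perturb`). Hence f ↦ fθ does not increase the
L^p-seminorms. As θ⁻¹ implements the reverse equivalence (`IsExteriorEquivalence.symm`), the inverse
map f ↦ fθ⁻¹ does not increase them either, so both are isometric and extend to the completions.

Multiplicativity needs no computation with the twisted convolutions: elements of L¹ are identified
in the completion when all integrated forms agree on them, and integrated forms are multiplicative
(`coe_mapL1R_conv`). -/

namespace LpCrossed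

noncomputable section

/-! ### Multipliers of algebras with an approximate identity -/

section Faithful

variable {A : Type*} [NonUnitalNormedRing A] [HasCAI A]

/-- Take c along the approximate unit and pass to the limit. With its mirror image, this allows
identities between multipliers to be tested after multiplication by elements of A. -/
theorem eq_of_forall_mul_left_eq {a b : A} (h : ∀ c, c * a = c * b) : a = b := by
  obtain ⟨l, hl, -⟩ := HasCAI.exists_cai (A := A)
  have := hl.neBot
  have ha := hl.tendsto_mul_right a
  simp only [h] at ha
  exact tendsto_nhds_unique ha (hl.tendsto_mul_right b)

theorem eq_of_forall_mul_right_eq {a b : A} (h : ∀ c, a * c = b * c) : a = b := by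
  obtain ⟨l, hl, -⟩ := HasCAI.exists_cai (A := A)
  have := hl.neBot
  have ha := hl.tendsto_mul_left a
  simp only [h] at ha
  exact tendsto_nhds_unique ha (hl.tendsto_mul_left b)

end Faithful

section Multipliers

variable {A : Type*} [NonUnitalNormedRing A] [NormedSpace ℂ A] [SMulCommClass ℂ A A]
  [IsScalarTower ℂ A A]

theorem lact_mul (s t : 𝓜(ℂ, A)) (a : A) : lact (s * t) a = lact s (lact t a) := rfl

theorem ract_mul (a : A) (s t : 𝓜(ℂ, A)) : ract a (s * t) = ract (ract a s) t := rfl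

@[simp] theorem lact_one (a : A) : lact (1 : 𝓜(ℂ, A)) a = a := rfl

@[simp] theorem ract_one (a : A) : ract a (1 : 𝓜(ℂ, A)) = a := rfl

@[simp] theorem lact_inv_lact (t : 𝓜(ℂ, A)ˣ) (a : A) :
    lact ((t⁻¹ : 𝓜(ℂ, A)ˣ) : 𝓜(ℂ, A)) (lact (t : 𝓜(ℂ, A)) a) = a := by
  rw [← lact_mul, Units.inv_mul, lact_one]

@[simp] theorem lact_lact_inv (t : 𝓜(ℂ, A)ˣ) (a : A) :
    lact (t : 𝓜(ℂ, A)) (lact ((t⁻¹ : 𝓜(ℂ, A)ˣ) : 𝓜(ℂ, A)) a) = a := by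
  rw [← lact_mul, Units.mul_inv, lact_one]

@[simp] theorem ract_ract_inv (t : 𝓜(ℂ, A)ˣ) (a : A) :
    ract (ract a (t : 𝓜(ℂ, A))) ((t⁻¹ : 𝓜(ℂ, A)ˣ) : 𝓜(ℂ, A)) = a := by
  rw [← ract_mul, Units.mul_inv, ract_one]

@[simp] theorem ract_inv_ract (t : 𝓜(ℂ, A)ˣ) (a : A) :
    ract (ract a ((t⁻¹ : 𝓜(ℂ, A)ˣ) : 𝓜(ℂ, A))) (t : 𝓜(ℂ, A)) = a := by
  rw [← ract_mul, Units.inv_mul, ract_one]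

theorem lact_sub (t : 𝓜(ℂ, A)) (a b : A) : lact t (a - b) = lact t a - lact t b :=
  map_sub t.fst a b

theorem ract_sub (t : 𝓜(ℂ, A)) (a b : A) : ract (a - b) t = ract a t - ract b t :=
  map_sub t.snd a b

theorem ract_mul_eq_mul_lact (t : 𝓜(ℂ, A)) (a b : A) : ract a t * b = a * lact t b :=
  t.central a b

theorem inv_mem_Inv₁ {t : 𝓜(ℂ, A)ˣ} (ht : t ∈ Inv₁ A) : t⁻¹ ∈ Inv₁ A :=
  ⟨ht.2, by simpa using ht.1⟩

theorem norm_lact_le_of_mem_Inv₁ {t : 𝓜(ℂ, A)ˣ} (ht : t ∈ Inv₁ A) (a : A) :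
    ‖lact (t : 𝓜(ℂ, A)) a‖ ≤ ‖a‖ := by
  simpa [ht.1] using norm_lact_le (t : 𝓜(ℂ, A)) a

theorem norm_ract_le_of_mem_Inv₁ {t : 𝓜(ℂ, A)ˣ} (ht : t ∈ Inv₁ A) (a : A) :
    ‖ract a (t : 𝓜(ℂ, A))‖ ≤ ‖a‖ := by
  simpa [ht.1] using norm_ract_le (t : 𝓜(ℂ, A)) a

/-- Inversion preserves left strict continuity on `Inv₁(M(A))`. -/
theorem continuous_lact_inv {X : Type*} [TopologicalSpace X] {θ : X → 𝓜(ℂ, A)ˣ}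
    (hθ : ∀ x, θ x ∈ Inv₁ A) (hc : ∀ a : A, Continuous fun x => lact (θ x : 𝓜(ℂ, A)) a) (a : A) :
    Continuous fun x => lact (((θ x)⁻¹ : 𝓜(ℂ, A)ˣ) : 𝓜(ℂ, A)) a := by
  refine continuous_iff_continuousAt.2 fun x₀ => tendsto_iff_norm_sub_tendsto_zero.2 ?_
  -- With b = θ_{x₀}⁻¹a one has θ_x⁻¹a − b = θ_x⁻¹(a − θ_x b). As θ_x⁻¹ is contractive, the norm is
  -- at most ‖a − θ_x b‖, which tends to 0 because θ_{x₀}b = a.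
  set b := lact (((θ x₀)⁻¹ : 𝓜(ℂ, A)ˣ) : 𝓜(ℂ, A)) a with hb
  have hlim : Tendsto (fun x => ‖a - lact (θ x : 𝓜(ℂ, A)) b‖) (𝓝 x₀) (𝓝 0) := by
    have := (continuous_const.sub (hc b)).norm.tendsto
      (f := fun x => ‖a - lact (θ x : 𝓜(ℂ, A)) b‖) x₀
    simpa [hb] using this
  refine squeeze_zero (fun _ => norm_nonneg _) (fun x => ?_) hlim
  refine le_trans (le_of_eq ?_) (norm_lact_le_of_mem_Inv₁ (inv_mem_Inv₁ (hθ x)) _)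
  rw [lact_sub, lact_inv_lact]

/-- Inversion preserves right strict continuity on `Inv₁(M(A))`. -/
theorem continuous_ract_inv {X : Type*} [TopologicalSpace X] {θ : X → 𝓜(ℂ, A)ˣ}
    (hθ : ∀ x, θ x ∈ Inv₁ A) (hc : ∀ a : A, Continuous fun x => ract a (θ x : 𝓜(ℂ, A))) (a : A) :
    Continuous fun x => ract a (((θ x)⁻¹ : 𝓜(ℂ, A)ˣ) : 𝓜(ℂ, A)) := by
  refine continuous_iff_continuousAt.2 fun x₀ => tendsto_iff_norm_sub_tendsto_zero.2 ?_
  set b := ract a (((θ x₀)⁻¹ : 𝓜(ℂ, A)ˣ) : 𝓜(ℂ, A)) with hb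
  have hlim : Tendsto (fun x => ‖a - ract b (θ x : 𝓜(ℂ, A))‖) (𝓝 x₀) (𝓝 0) := by
    have := (continuous_const.sub (hc b)).norm.tendsto
      (f := fun x => ‖a - ract b (θ x : 𝓜(ℂ, A))‖) x₀
    simpa [hb] using this
  refine squeeze_zero (fun _ => norm_nonneg _) (fun x => ?_) hlim
  refine le_trans (le_of_eq ?_) (norm_ract_le_of_mem_Inv₁ (inv_mem_Inv₁ (hθ x)) _)
  rw [ract_sub, ract_ract_inv]

theorem Aut.onM_one (φ : Aut A) : φ.onM (1 : 𝓜(ℂ, A)) = 1 := by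
  refine DoubleCentralizer.ext _ _ _ _ (Prod.ext ?_ ?_) <;> ext a <;> simp [Aut.onM]

theorem Aut.onM_mul (φ : Aut A) (s t : 𝓜(ℂ, A)) : φ.onM (s * t) = φ.onM s * φ.onM t := by
  refine DoubleCentralizer.ext _ _ _ _ (Prod.ext ?_ ?_) <;> ext a <;> simp [Aut.onM]

variable [HasCAI A]

/-- A double centralizer is only required to satisfy (ct)a = c(ta). The module property follows by
faithfulness: c·t(ab) = (ct)ab = c(ta)b for every c. -/
theorem lact_mul_right (t : 𝓜(ℂ, A)) (a b : A) : lact t (a * b) = lact t a * b :=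
  eq_of_forall_mul_left_eq fun c => by
    rw [← ract_mul_eq_mul_lact, ← mul_assoc, ← mul_assoc, ract_mul_eq_mul_lact]

/-- Multiplied by c on the right, both sides become (sa)(tc). This associativity is what makes `Ad`,
which mixes the two actions, computable. -/
theorem lact_ract (s t : 𝓜(ℂ, A)) (a : A) : lact s (ract a t) = ract (lact s a) t :=
  eq_of_forall_mul_right_eq fun c => by
    rw [← lact_mul_right, ract_mul_eq_mul_lact, ract_mul_eq_mul_lact, lact_mul_right]

/-- A multiplier is determined by its left action. -/
theorem multiplier_ext {s t : 𝓜(ℂ, A)} (h : ∀ a, lact s a = lact t a) : s = t := by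
  refine DoubleCentralizer.ext _ _ _ _ (Prod.ext ?_ ?_)
  · exact ContinuousLinearMap.ext h
  -- The left action recovers the right one through (as)c = a(sc).
  · refine ContinuousLinearMap.ext fun a => eq_of_forall_mul_right_eq fun c => ?_
    exact (s.central a c).trans ((congrArg (a * ·) (h c)).trans (t.central a c).symm)

theorem Ad_inv_Ad (t : 𝓜(ℂ, A)ˣ) (a : A) : Ad t⁻¹ (Ad t a) = a := by
  simp [Ad, lact_ract]

/-- If `ψ = Ad(t) ∘ φ` on `A`, then `ψ = Ad(t) ∘ φ` on `M(A)`. -/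
theorem Aut.onM_eq_conj {φ ψ : Aut A} {t : 𝓜(ℂ, A)ˣ} (h : ∀ a, ψ a = Ad t (φ a)) (s : 𝓜(ℂ, A)) :
    ψ.onM s = t * φ.onM s * ((t⁻¹ : 𝓜(ℂ, A)ˣ) : 𝓜(ℂ, A)) := by
  refine multiplier_ext fun a => ?_
  -- On a = ψ(b) = tφ(b)t⁻¹ both multipliers give tφ(sb)t⁻¹ = ψ(sb).
  obtain ⟨b, rfl⟩ := ψ.toLinearIsometryEquiv.surjective a
  rw [Aut.lact_onM, h, h, Ad, Ad, lact_mul, lact_mul, lact_ract _ _ (lact _ (φ b)),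
    lact_inv_lact, lact_ract, lact_ract, Aut.lact_onM]

end Multipliers

/-! ### The extension of a nondegenerate representation to the multiplier algebra -/

section Hat

variable {A : Type*} [NonUnitalNormedRing A] [NormedSpace ℂ A] [SMulCommClass ℂ A A]
  [IsScalarTower ℂ A A] [HasCAI A]
  {E : Type*} [NormedAddCommGroup E] [NormedSpace ℂ E] [CompleteSpace E] {π : Rep A E}

theorem Rep.hat_one (hπ : π.IsNondegenerate) : π.hat (1 : 𝓜(ℂ, A)) = 1 :=
  Rep.ext_of_nondegenerate hπ fun a ξ => Rep.hat_apply hπ _ a ξ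

theorem Rep.hat_mul (hπ : π.IsNondegenerate) (s t : 𝓜(ℂ, A)) (ξ : E) :
    π.hat (s * t) ξ = π.hat s (π.hat t ξ) := by
  have h : π.hat (s * t) = π.hat s * π.hat t := Rep.ext_of_nondegenerate hπ fun a ξ => by
    rw [mul_apply_eq_comp, Rep.hat_apply hπ, Rep.hat_apply hπ, Rep.hat_apply hπ,
      lact_mul]
  rw [h, mul_apply_eq_comp]

/-- The estimate is `Rep.norm_action_le` on the dense range of `π.action`, and it is a closed
condition on ξ. -/
theorem Rep.norm_hat_apply_le (hπ : π.IsNondegenerate) (t : 𝓜(ℂ, A)) (ξ : E) :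
    ‖π.hat t ξ‖ ≤ ‖π.toCLM‖ * ‖t‖ * ‖ξ‖ := by
  refine (Rep.denseRange_action hπ).induction_on 
    (p := fun ξ => ‖π.hat t ξ‖ ≤ ‖π.toCLM‖ * ‖t‖ * ‖ξ‖) ξ
    (isClosed_le (by fun_prop) (by fun_prop)) fun x => ?_
  rw [Rep.hat, LinearMap.extendOfNorm_eq (Rep.denseRange_action hπ) ⟨_, Rep.norm_action_le π t⟩]
  exact Rep.norm_action_le π t x

theorem Rep.norm_hat_apply_le_of_mem_Inv₁ (hπ : π.IsNondegenerate) (hc : π.IsContractive)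
    {t : 𝓜(ℂ, A)ˣ} (ht : t ∈ Inv₁ A) (ξ : E) : ‖π.hat (t : 𝓜(ℂ, A)) ξ‖ ≤ ‖ξ‖ := by
  refine (Rep.norm_hat_apply_le hπ _ ξ).trans ?_
  rw [ht.1, mul_one]
  exact mul_le_of_le_one_left (norm_nonneg _) hc

/-- For contractive `π`, the extension `π̂` maps `Inv₁(M(A))` to invertible isometries. -/
def Rep.hatIsometry (hπ : π.IsNondegenerate) (hc : π.IsContractive) {t : 𝓜(ℂ, A)ˣ}
    (ht : t ∈ Inv₁ A) : E ≃ₗᵢ[ℂ] E :=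
  -- Mutually inverse contractions are isometries.
  LinearIsometryEquiv.ofBounds
    (LinearEquiv.ofLinearMap (π.hat (t : 𝓜(ℂ, A))).toLinearMap
      (π.hat ((t⁻¹ : 𝓜(ℂ, A)ˣ) : 𝓜(ℂ, A))).toLinearMap
      (by
        ext ξ
        change π.hat _ (π.hat _ ξ) = ξ
        rw [← Rep.hat_mul hπ, Units.mul_inv, Rep.hat_one hπ, one_apply_eq_self])
      (by
        ext ξ
        change π.hat _ (π.hat _ ξ) = ξ
        rw [← Rep.hat_mul hπ, Units.inv_mul, Rep.hat_one hπ, one_apply_eq_self]))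
    (fun ξ => Rep.norm_hat_apply_le_of_mem_Inv₁ hπ hc ht ξ)
    (fun ξ => Rep.norm_hat_apply_le_of_mem_Inv₁ hπ hc (inv_mem_Inv₁ ht) ξ)

theorem Rep.hatIsometry_apply (hπ : π.IsNondegenerate) (hc : π.IsContractive) {t : 𝓜(ℂ, A)ˣ}
    (ht : t ∈ Inv₁ A) (ξ : E) : Rep.hatIsometry hπ hc ht ξ = π.hat (t : 𝓜(ℂ, A)) ξ := rfl

theorem Rep.hatIsometry_symm_apply (hπ : π.IsNondegenerate) (hc : π.IsContractive)
    {t : 𝓜(ℂ, A)ˣ} (ht : t ∈ Inv₁ A) (ξ : E) :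
    (Rep.hatIsometry hπ hc ht).symm ξ = π.hat ((t⁻¹ : 𝓜(ℂ, A)ˣ) : 𝓜(ℂ, A)) ξ := rfl

/-- Each π̂(θ_x) is 1-Lipschitz, so continuity in x need only be checked on the dense span of the
vectors π(a)η, where π̂(θ_x)π(a)η = π(θ_x a)η. Joint continuity is needed because it is later
applied to the moving vector u_xξ. -/
theorem Rep.continuous_hat (hπ : π.IsNondegenerate) (hc : π.IsContractive) {X : Type*}
    [TopologicalSpace X] {θ : X → 𝓜(ℂ, A)ˣ} (hθ : ∀ x, θ x ∈ Inv₁ A)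
    (hl : ∀ a : A, Continuous fun x => lact (θ x : 𝓜(ℂ, A)) a) :
    Continuous fun q : X × E => π.hat (θ q.1 : 𝓜(ℂ, A)) q.2 := by
  refine continuous_prod_of_dense_continuous_lipschitzWith'
    (fun q : X × E => π.hat (θ q.1 : 𝓜(ℂ, A)) q.2) 1 hπ (fun x => ?_) (fun ξ hξ => ?_)
  · exact (Rep.hatIsometry hπ hc (hθ x)).lipschitz
  · refine Submodule.span_induction (p := fun ξ _ => Continuous fun x => π.hat (θ x : 𝓜(ℂ, A)) ξ)
      ?_ ?_ ?_ ?_ hξ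
    · rintro _ ⟨a, η, rfl⟩
      have hca : Continuous fun b : A => π b η := by fun_prop
      simp only [Rep.hat_apply hπ]
      exact hca.comp (hl a)
    · simpa using continuous_const
    · intro ξ η _ _ h₁ h₂
      simpa only [map_add] using Continuous.fun_add h₁ h₂
    · intro c ξ _ h
      simpa only [map_smul] using Continuous.fun_const_smul h c

end Hat

/-! ### Exterior equivalence -/

section Exterior

variable {G : Type u} [Group G] [TopologicalSpace G]
  {A : Type v} [NonUnitalNormedRing A] [NormedSpace ℂ A] [SMulCommClass ℂ A A]
  [IsScalarTower ℂ A A]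

/-- The family `θ` implements an exterior equivalence from `S = (α, σ)` to `T = (β, ω)`. -/
structure IsExteriorEquivalence (S T : TwistedAction G A) (θ : G → 𝓜(ℂ, A)ˣ) : Prop where
  mem : ∀ x, θ x ∈ Inv₁ A
  continuous_lact : ∀ a : A, Continuous fun x => lact (θ x : 𝓜(ℂ, A)) a
  continuous_ract : ∀ a : A, Continuous fun x => ract a (θ x : 𝓜(ℂ, A))
  α_eq : ∀ (x : G) (a : A), T.α x a = Ad (θ x) (S.α x a)
  σ_mul : ∀ x y : G, (T.σ x y : 𝓜(ℂ, A)) * (θ (x * y) : 𝓜(ℂ, A)) =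
    (θ x : 𝓜(ℂ, A)) * (S.α x).onM (θ y : 𝓜(ℂ, A)) * (S.σ x y : 𝓜(ℂ, A))

variable [HasCAI A] {S T : TwistedAction G A} {θ : G → 𝓜(ℂ, A)ˣ}

/-- This symmetry upgrades the one-sided seminorm estimate to an isometry. -/
theorem IsExteriorEquivalence.symm (h : IsExteriorEquivalence S T θ) :
    IsExteriorEquivalence T S fun x => (θ x)⁻¹ where
  mem x := inv_mem_Inv₁ (h.mem x)
  continuous_lact := continuous_lact_inv h.mem h.continuous_lact
  continuous_ract := continuous_ract_inv h.mem h.continuous_ract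
  α_eq x a := by rw [h.α_eq, Ad_inv_Ad]
  σ_mul x y := by
    have hinv : (S.α x).onM (((θ y)⁻¹ : 𝓜(ℂ, A)ˣ) : 𝓜(ℂ, A)) *
        (S.α x).onM (θ y : 𝓜(ℂ, A)) = 1 := by
      rw [← Aut.onM_mul, Units.inv_mul, Aut.onM_one]
    -- On M(A), β_x = Ad(θ_x) ∘ α_x, so with θ_{xy} moved to the right the claim is σ_{x,y} =
    -- α_x(θ_y⁻¹)θ_x⁻¹ω_{x,y}θ_{xy}; substituting the relation for ω_{x,y}θ_{xy} cancels all the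
    -- θ's.
    rw [Aut.onM_eq_conj (h.α_eq x), Units.mul_inv_eq_iff_eq_mul, mul_assoc _ (T.σ x y : 𝓜(ℂ, A)),
      h.σ_mul]
    simp only [mul_assoc, Units.inv_mul_cancel_left]
    rw [← mul_assoc, hinv, one_mul]

end Exterior

/-! ### Perturbing covariant representations by an exterior equivalence -/

namespace CovariantRep

variable {G : Type u} [Group G] [TopologicalSpace G]
  {A : Type v} [NonUnitalNormedRing A] [NormedSpace ℂ A] [SMulCommClass ℂ A A]
  [IsScalarTower ℂ A A] {S T : TwistedAction G A} {θ : G → 𝓜(ℂ, A)ˣ}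
  {E : Type w} [NormedAddCommGroup E] [NormedSpace ℂ E] [CompleteSpace E]

theorem u_apply_π (R : CovariantRep S E) (x : G) (a : A) (ξ : E) :
    R.u x (R.π a ξ) = R.π (S.α x a) (R.u x ξ) := by
  rw [R.covariant, LinearIsometryEquiv.symm_apply_apply]

variable [HasCAI A]

/-- The covariance condition extends to multipliers. -/
theorem u_apply_hat (R : CovariantRep S E) (x : G) (t : 𝓜(ℂ, A)) (ξ : E) :
    R.u x (R.π.hat t ξ) = R.π.hat ((S.α x).onM t) (R.u x ξ) := by
  have h : ((R.u x : E ≃L[ℂ] E) : E →L[ℂ] E) ∘L R.π.hat t =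
      R.π.hat ((S.α x).onM t) ∘L ((R.u x : E ≃L[ℂ] E) : E →L[ℂ] E) := by
    refine Rep.ext_of_nondegenerate R.nondegenerate fun a η => ?_
    change R.u x (R.π.hat t (R.π a η)) = R.π.hat ((S.α x).onM t) (R.u x (R.π a η))
    rw [Rep.hat_apply R.nondegenerate, u_apply_π, u_apply_π, Rep.hat_apply R.nondegenerate,
      Aut.lact_onM]
  exact DFunLike.congr_fun h ξ

/-- An exterior equivalence `θ` from `S` to `T` turns a contractive covariant representation
`(π, u)` of `S` into the covariant representation `(π, x ↦ π̂(θ_x)u_x)` of `T`. -/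
def perturb (R : CovariantRep S E) (hR : R.π.IsContractive) (h : IsExteriorEquivalence S T θ) :
    CovariantRep T E where
  π := R.π
  nondegenerate := R.nondegenerate
  u x := (R.u x).trans (Rep.hatIsometry R.nondegenerate hR (h.mem x))
  continuous_u ξ := by
    have hc := Rep.continuous_hat R.nondegenerate hR h.mem h.continuous_lact
    exact hc.comp (f := fun x => (x, R.u x ξ)) (continuous_id.prodMk (R.continuous_u ξ))
  u_mul x y ξ := by
    simp only [LinearIsometryEquiv.trans_apply, Rep.hatIsometry_apply]
    -- v_x v_y = π̂(θ_x α_x(θ_y) σ_{x,y})u_{xy} = π̂(ω_{x,y}θ_{xy})u_{xy} = π̂(ω_{x,y})v_{xy}.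
    rw [u_apply_hat, R.u_mul]
    simp only [← Rep.hat_mul R.nondegenerate]
    rw [h.σ_mul, mul_assoc]
  covariant x a ξ := by
    simp only [LinearIsometryEquiv.trans_apply, LinearIsometryEquiv.symm_trans,
      Rep.hatIsometry_apply, Rep.hatIsometry_symm_apply]
    -- v_xπ(a)v_x⁻¹ = π̂(θ_x)π(α_x(a))π̂(θ_x⁻¹) = π(θ_x α_x(a) θ_x⁻¹).
    rw [h.α_eq, Ad, Rep.apply_ract R.nondegenerate, ← R.covariant, Rep.hat_apply R.nondegenerate]

theorem perturb_u_apply (R : CovariantRep S E) (hR : R.π.IsContractive)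
    (h : IsExteriorEquivalence S T θ) (x : G) (ξ : E) :
    (R.perturb hR h).u x ξ = R.π.hat (θ x : 𝓜(ℂ, A)) (R.u x ξ) := rfl

end CovariantRep

/-! ### Multiplication by a strictly continuous family of multipliers on `L¹(G; A)` -/

section RactL1

variable {G : Type u} [TopologicalSpace G] [TopologicalSpace.PseudoMetrizableSpace G]
  [SecondCountableTopology G]  [MeasurableSpace G] [BorelSpace G] {ν : Measure G}
  {A : Type v} [NonUnitalNormedRing A] [NormedSpace ℂ A] [SMulCommClass ℂ A A]
  [IsScalarTower ℂ A A] {θ : G → 𝓜(ℂ, A)ˣ}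

/-- Right strict continuity together with the bound ‖aθ_x‖ ≤ ‖a‖ makes (x, a) ↦ aθ_x jointly
continuous. This carries strong measurability from f to fθ, and the same bound gives domination by
f. -/
theorem integrable_ract (hθ : ∀ x, θ x ∈ Inv₁ A)
    (hc : ∀ a : A, Continuous fun x => ract a (θ x : 𝓜(ℂ, A))) {f : G → A} (hf : Integrable f ν) :
    Integrable (fun x => ract (f x) (θ x : 𝓜(ℂ, A))) ν := by
  have hcont : Continuous fun q : G × A => ract q.2 (θ q.1 : 𝓜(ℂ, A)) := by
    refine continuous_prod_of_continuous_lipschitzWith' _ 1 (fun x => ?_) hc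
    refine LipschitzWith.of_dist_le_mul fun a b => ?_
    simpa [dist_eq_norm, ract_sub] using norm_ract_le_of_mem_Inv₁ (hθ x) (a - b)
  have hid : AEStronglyMeasurable (fun x : G => x) ν := continuous_id.aestronglyMeasurable
  exact hf.mono (hcont.comp_aestronglyMeasurable (hid.prodMk hf.aestronglyMeasurable))
    (Eventually.of_forall fun x => norm_ract_le_of_mem_Inv₁ (hθ x) _)

/-- The map `f ↦ (x ↦ f(x)θ_x)` on `L¹(G; A)`. -/
def ractL1 (ν : Measure G) (hθ : ∀ x, θ x ∈ Inv₁ A)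
    (hc : ∀ a : A, Continuous fun x => ract a (θ x : 𝓜(ℂ, A))) : Lp A 1 ν →ₗ[ℂ] Lp A 1 ν where
  toFun f := (integrable_ract hθ hc (L1.integrable_coeFn f)).toL1 _
  map_add' f g := by
    rw [← Integrable.toL1_add]
    refine (Integrable.toL1_eq_toL1_iff _ _ _ _).2 ?_
    filter_upwards [Lp.coeFn_add f g] with x hx
    simp only [hx, Pi.add_apply, ract, map_add]
  map_smul' c f := by
    rw [RingHom.id_apply, ← Integrable.toL1_smul]
    refine (Integrable.toL1_eq_toL1_iff _ _ _ _).2 ?_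
    filter_upwards [Lp.coeFn_smul c f] with x hx
    simp only [hx, Pi.smul_apply, ract, map_smul]

theorem coeFn_ractL1 (hθ : ∀ x, θ x ∈ Inv₁ A)
    (hc : ∀ a : A, Continuous fun x => ract a (θ x : 𝓜(ℂ, A))) (f : Lp A 1 ν) :
    ractL1 ν hθ hc f =ᵐ[ν] fun x => ract (f x) (θ x : 𝓜(ℂ, A)) :=
  Integrable.coeFn_toL1 (integrable_ract hθ hc (L1.integrable_coeFn f))

end RactL1

/-- Mutually inverse linear contractions of seminormed spaces induce an isometric isomorphism of
the completions. -/
theorem exists_completion_linearIsometryEquiv {X Y : Type*} [SeminormedAddCommGroup X]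
    [NormedSpace ℂ X] [SeminormedAddCommGroup Y] [NormedSpace ℂ Y] (f : X →ₗ[ℂ] Y) (g : Y →ₗ[ℂ] X)
    (hf : ∀ x, ‖f x‖ ≤ ‖x‖) (hg : ∀ y, ‖g y‖ ≤ ‖y‖) (hgf : ∀ x, g (f x) = x)
    (hfg : ∀ y, f (g y) = y) :
    ∃ Ψ : UniformSpace.Completion X ≃ₗᵢ[ℂ] UniformSpace.Completion Y,
      ∀ x : X, Ψ (x : UniformSpace.Completion X) = (f x : UniformSpace.Completion Y) := by
  -- The reverse inequality is ‖x‖ = ‖g(f(x))‖ ≤ ‖f(x)‖.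
  let F : X →ₗᵢ[ℂ] Y := ⟨f, fun x => (hf x).antisymm (by simpa [hgf] using hg (f x))⟩
  let ι : X →L[ℂ] UniformSpace.Completion X := UniformSpace.Completion.toComplL
  let F' : UniformSpace.Completion X →L[ℂ] UniformSpace.Completion Y :=
    ((UniformSpace.Completion.toComplL : Y →L[ℂ] UniformSpace.Completion Y) ∘L
      F.toContinuousLinearMap).extend ι
  have hF : ∀ x : X, F' (x : UniformSpace.Completion X) = (f x : UniformSpace.Completion Y) :=
    fun x => ContinuousLinearMap.extend_eq _ UniformSpace.Completion.denseRange_coe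
      (UniformSpace.Completion.isUniformInducing_coe _) x
  have hnorm : ∀ c, ‖F' c‖ = ‖c‖ := fun c => by
    induction c using UniformSpace.Completion.induction_on with
    | hp => exact isClosed_eq (by fun_prop) (by fun_prop)
    | ih x =>
      rw [hF, UniformSpace.Completion.norm_coe, UniformSpace.Completion.norm_coe]
      exact F.norm_map x
  let J : UniformSpace.Completion X →ₗᵢ[ℂ] UniformSpace.Completion Y := ⟨F'.toLinearMap, hnorm⟩
  -- The isometric image of a complete space is closed, and it contains the dense image of Y.
  have hclosed : IsClosed (Set.range J) := J.isometry.isClosedEmbedding.isClosed_range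
  have hsurj : Function.Surjective J := fun d => by
    induction d using UniformSpace.Completion.induction_on with
    | hp => exact hclosed
    | ih y => exact ⟨(g y : UniformSpace.Completion X), (hF _).trans (by rw [hfg])⟩
  exact ⟨LinearIsometryEquiv.ofSurjective J hsurj, hF⟩

/-! ### The isometry f ↦ fθ and its multiplicativity -/

section Main

variable {G : Type u} [Group G] [TopologicalSpace G] [IsTopologicalGroup G]
  [LocallyCompactSpace G] [T2Space G] [SecondCountableTopology G]
  [MeasurableSpace G] [BorelSpace G] {ν : Measure G}
  {A : Type v} [NonUnitalNormedRing A] [NormedSpace ℂ A] [SMulCommClass ℂ A A]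
  [IsScalarTower ℂ A A] [CompleteSpace A] [HasCAI A]
  {S T : TwistedAction G A} {θ : G → 𝓜(ℂ, A)ˣ}

/-- `(π ⋊ v)(f) = (π ⋊ u)(fθ)` for `v_x = π̂(θ_x)u_x`. -/
theorem CovariantRep.integrated_perturb {E : Type w} [NormedAddCommGroup E] [NormedSpace ℂ E]
    [CompleteSpace E] (R : CovariantRep S E) (hR : R.π.IsContractive)
    (h : IsExteriorEquivalence S T θ) (f : Lp A 1 ν) :
    (R.perturb hR h).integrated ν f = R.integrated ν (ractL1 ν h.mem h.continuous_ract f) := by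
  ext ξ
  rw [CovariantRep.integrated_apply, CovariantRep.integrated_apply]
  refine integral_congr_ae ?_
  filter_upwards [coeFn_ractL1 h.mem h.continuous_ract f] with x hx
  -- The integrands agree almost everywhere, by π(f(x)θ_x) = π(f(x))π̂(θ_x).
  rw [hx, Rep.apply_ract R.nondegenerate, CovariantRep.perturb_u_apply]
  rfl

namespace IsExteriorEquivalence

variable {p : ℝ≥0∞} [Fact (1 ≤ p)]

/-- Perturbation of contractive covariant representations on `L^p`-spaces. -/
def mapLpRep (h : IsExteriorEquivalence S T θ) (R : LpCovariantRep.{u, v, w} p S) :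
    LpCovariantRep.{u, v, w} p T where
  Ω := R.Ω
  μ := R.μ
  rep := R.rep.perturb R.contractive h
  contractive := R.contractive

/-- The map `f ↦ fθ` from `L¹(G, A, β, ω)` to `L¹(G, A, α, σ)`. -/
def mapL1R (p : ℝ≥0∞) [Fact (1 ≤ p)] (ν : Measure G) (h : IsExteriorEquivalence S T θ) :
    (lpFamily.{u, v, w} p T).L1R ν →ₗ[ℂ] (lpFamily.{u, v, w} p S).L1R ν :=
  ractL1 ν h.mem h.continuous_ract

theorem integratedL1R_mapL1R (h : IsExteriorEquivalence S T θ) (R : LpCovariantRep.{u, v, w} p S)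
    (f : (lpFamily.{u, v, w} p T).L1R ν) :
    (lpFamily p S).integratedL1R ν R (h.mapL1R p ν f) =
      (lpFamily p T).integratedL1R ν (h.mapLpRep R) f :=
  (R.rep.integrated_perturb R.contractive h f).symm

/-- Every term of the supremum defining ‖fθ‖ is, after perturbing the representation, a term of the
supremum defining ‖f‖. -/
theorem norm_mapL1R_le (h : IsExteriorEquivalence S T θ) (f : (lpFamily.{u, v, w} p T).L1R ν) :
    ‖h.mapL1R p ν f‖ ≤ ‖f‖ := by
  rw [RepFamily.norm_eq]
  refine Real.iSup_le (fun R => ?_) (norm_nonneg _)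
  refine (congrArg norm (h.integratedL1R_mapL1R R f)).le.trans ?_
  exact RepFamily.norm_integratedL1R_le _ (h.mapLpRep R) f

theorem mapL1R_symm_mapL1R (h : IsExteriorEquivalence S T θ)
    (f : (lpFamily.{u, v, w} p T).L1R ν) : h.symm.mapL1R p ν (h.mapL1R p ν f) = f := by
  refine Lp.ext (p := 1) (μ := ν) ?_
  filter_upwards [coeFn_ractL1 (ν := ν) h.mem h.continuous_ract f,
    coeFn_ractL1 (ν := ν) h.symm.mem h.symm.continuous_ract
      (ractL1 ν h.mem h.continuous_ract f)] with x hx hx'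
  refine hx'.trans ?_
  rw [hx, ract_ract_inv]

theorem mapL1R_mapL1R_symm (h : IsExteriorEquivalence S T θ)
    (f : (lpFamily.{u, v, w} p S).L1R ν) : h.mapL1R p ν (h.symm.mapL1R p ν f) = f := by
  refine Lp.ext (p := 1) (μ := ν) ?_
  filter_upwards [coeFn_ractL1 (ν := ν) h.symm.mem h.symm.continuous_ract f,
    coeFn_ractL1 (ν := ν) h.mem h.continuous_ract
      (ractL1 ν h.symm.mem h.symm.continuous_ract f)] with x hx hx'
  refine hx'.trans ?_
  rw [hx, ract_inv_ract]

/-- Equality in the completion is tested on the integrated forms of S. Each of these, composed with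
f ↦ fθ, is an integrated form of T, and both kinds are multiplicative. -/
theorem coe_mapL1R_conv [ν.IsHaarMeasure] (h : IsExteriorEquivalence S T θ)
    (f g : (lpFamily.{u, v, w} p T).L1R ν) :
    (h.mapL1R p ν ((lpFamily p T).conv f g) : FullLpCrossedProduct.{u, v, w} p ν S) =
      ((lpFamily p S).conv (h.mapL1R p ν f) (h.mapL1R p ν g) : (lpFamily p S).L1R ν) := by
  refine RepFamily.coe_eq_coe _ fun R => ?_
  refine (h.integratedL1R_mapL1R R _).trans ?_
  refine (RepFamily.integratedL1R_conv _ (h.mapLpRep R) f g).trans ?_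
  refine Eq.trans ?_ (RepFamily.integratedL1R_conv _ R _ _).symm
  exact congrArg₂ (· * ·) (h.integratedL1R_mapL1R R f).symm (h.integratedL1R_mapL1R R g).symm

end IsExteriorEquivalence

end Main

end

end LpCrossed

theorem mainTheorem6 {p : ℝ≥0∞} [Fact (1 ≤ p)] (hp : p ≠ ∞)
    {G : Type u} [Group G] [TopologicalSpace G] [IsTopologicalGroup G]
    [LocallyCompactSpace G] [T2Space G] [SecondCountableTopology G]
    [MeasurableSpace G] [BorelSpace G] (ν : Measure G) [ν.IsHaarMeasure]
    {A : Type v} [NonUnitalNormedRing A] [NormedSpace ℂ A] [SMulCommClass ℂ A A]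
    [IsScalarTower ℂ A A] [CompleteSpace A] [LpCrossed.HasCAI A]
    (hA : LpCrossed.IsNondegenerateLpOperatorAlgebra.{v, z} p A)
    (S T : LpCrossed.TwistedAction G A) (hST : LpCrossed.ExteriorEquivalent S T) :
    ∃ Ψ : LpCrossed.FullLpCrossedProduct.{u, v, w} p ν S ≃ₗᵢ[ℂ]
        LpCrossed.FullLpCrossedProduct.{u, v, w} p ν T,
      ∀ c d, Ψ (c * d) = Ψ c * Ψ d := by
  obtain ⟨θ, h₁, h₂, h₃, h₄, h₅⟩ := hST
  have h : LpCrossed.IsExteriorEquivalence S T θ := ⟨h₁, h₂, h₃, h₄, h₅⟩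
  -- Going from S to T, Ψ extends f ↦ fθ⁻¹.
  obtain ⟨Ψ, hΨ⟩ := LpCrossed.exists_completion_linearIsometryEquiv
    (h.symm.mapL1R p ν) (h.mapL1R p ν) h.symm.norm_mapL1R_le h.norm_mapL1R_le
    h.mapL1R_mapL1R_symm h.mapL1R_symm_mapL1R
  refine ⟨Ψ, fun c d => ?_⟩
  -- Both sides are continuous in (c, d), so it suffices to compare them on the dense image of L¹.
  induction c, d using UniformSpace.Completion.induction_on₂ with
  | hp =>
    refine isClosed_eq (Ψ.continuous.comp ?_) ?_
    · exact LpCrossed.RepFamily.continuous_mul_crossedProduct _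
    · exact (LpCrossed.RepFamily.continuous_mul_crossedProduct _).comp
        ((Ψ.continuous.comp continuous_fst).prodMk (Ψ.continuous.comp continuous_snd))
  | ih f g =>
    rw [LpCrossed.RepFamily.coe_mul_coe, hΨ, hΨ, hΨ, LpCrossed.RepFamily.coe_mul_coe]
    exact h.symm.coe_mapL1R_conv f g
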